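/- Let $T$ be a complete first-order theory with monster model $\mathfrak C$. It suffices that $\mathfrak C\models T$ is $\kappa$-saturated for some cardinal $\kappa>|M|$, where $M$ is the model below. Let $\varphi(x,y)$ be a formula, with $x$ and $y$ finite tuples of variables, which is stable: there are no $(a_i)_{i<\omega}$, $(b_j)_{j<\omega}$ in $\mathfrak C$ such that $\mathfrak C\models\varphi(a_i,b_j)\iff i<j$. For a model $N\preceq\mathfrak C$, let $L_{\varphi,x}(N)$ be the Boolean algebra of Boolean combinations of instances $\varphi(x,b)$ with $b$ in $N$, up to equivalence in $\mathfrak C$. Let $S_\varphi(N)$ be the set of complete $\varphi$-types over $N$, i.e. maximal consistent subsets of $L_{\varphi,x}(N)$. For $r\in S_\varphi(N)$ and $\psi\in L_{\varphi,x}(N)$ put $r(\psi)=1$ if $\psi\in r$, and $r(\psi)=0$ otherwise. For a Boolean algebra $\mathcal B$, let $S_{\mathcal B,\varphi}(N)$ be the set of Boolean algebra homomorphisms $L_{\varphi,x}(N)\to\mathcal B$. Restriction to $M\preceq N$ is denoted by $q|_M$, and $\operatorname{supp}_\varphi(p)=\{r : p(\theta)>0\text{ for all }\theta\in r\}$. A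 formula $\theta(x,b)$ divides over $M$ if, for some $k<\omega$, there are realisations $(b_i)_{i<\omega}$ of $\operatorname{tp}(b/M)$ such that $\{\theta(x,b_i)\}_{i<\omega}$ is $k$-inconsistent. A formula forks over $M$ if it implies a finite disjunction of formulas (with parameters in $\mathfrak C$) each of which divides over $M$. A type $r\in S_\varphi(N)$ does not fork over $M$ if no $\theta\in r$ forks over $M$. A type $q\in S_{\mathcal B,\varphi}(N)$ does not fork over $M$ if $q(\theta)=0$ for every $\theta\in L_{\varphi,x}(N)$ which forks over $M$. **Theorem.** Let $\mathcal B$ be a complete Boolean algebra, let $M\preceq\mathfrak C$, and let $p\in S_{\mathcal B,\varphi}(M)$. Then there are a set $U\subseteq\operatorname{supp}_\varphi(p)$ and a maximal antichain $(\mathfrak b_r)_{r\in U}$ of nonzero elements of $\mathcal B$, depending only on $p$, such that for every $N$ with $M\preceq N\preceq\mathfrak C$: 1. every $r\in S_\varphi(M)$ has a unique extension $r|_N\in S_\varphi(N)$ that does not fork over $M$; 2. for every $q\in S_{\mathcal B,\varphi}(N)$ that does not fork over $M$ and satisfies $q|_M=p$, and for all $\psi\in L_{\varphi,x}(N)$,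 $$q(\psi)=\sum_{r\in U}\mathfrak b_r\cdot r|_N(\psi).$$ In particular, every $q\in S_{\mathcal B,\varphi}(N)$ that does not fork over $M$ is the unique extension of $q|_M$ to $S_{\mathcal B,\varphi}(N)$ that does not fork over $M$. -/

import Mathlib

open FirstOrder Cardinal

namespace BoolType

universe u v w

variable {L : FirstOrder.Language.{u, v}} {C : Type w} [L.Structure C]

section Saturation

variable (L C)

/-- `C` is `κ`-saturated: every finitely satisfiable set of formulas in one variable with
parameters in a set of size less than `κ` is realised in `C`. -/
def IsSaturated (κ : Cardinal.{w}) : Prop :=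
  ∀ A : Set C, #A < κ → ∀ Γ : Set (L[[A]].Formula (Fin 1)),
    (∀ F : Finset (L[[A]].Formula (Fin 1)), (F : Set (L[[A]].Formula (Fin 1))) ⊆ Γ →
      ∃ c : Fin 1 → C, ∀ χ ∈ F, χ.Realize c) →
    ∃ c : Fin 1 → C, ∀ χ ∈ Γ, χ.Realize c

end Saturation

/-- The subset of `C ^ n` defined by `φ(x, b)`. -/
def inst {n m : ℕ} (φ : L.Formula (Fin n ⊕ Fin m)) (b : Fin m → C) : Set (Fin n → C) :=
  {x | φ.Realize (Sum.elim x b)}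

variable (C) in
/-- `φ(x, y)` is stable: it does not have the order property in `C`. -/
def IsStable {n m : ℕ} (φ : L.Formula (Fin n ⊕ Fin m)) : Prop :=
  ¬ ∃ (a : ℕ → Fin n → C) (b : ℕ → Fin m → C), ∀ i j, a i ∈ inst φ (b j) ↔ i < j

section Forking

variable (L)

/-- The tuples `c` and `b` have the same type over `A`. -/
def SameType (A : Set C) {k : ℕ} (c b : Fin k → C) : Prop :=
  ∀ χ : L[[A]].Formula (Fin k), χ.Realize c ↔ χ.Realize b

/-- A definable set `D` divides over `A`: it is defined by some `ψ(x, b)` such that, for some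
`k`, there is a sequence of realisations `c i` of `tp(b / A)` for which the family
`ψ(x, c i)` is `k`-inconsistent. -/
def Divides (A : Set C) {n : ℕ} (D : Set (Fin n → C)) : Prop :=
  ∃ (l : ℕ) (ψ : L.Formula (Fin n ⊕ Fin l)) (b : Fin l → C), D = inst ψ b ∧
    ∃ (k : ℕ) (c : ℕ → Fin l → C), (∀ i, SameType L A (c i) b) ∧
      ∀ F : Finset ℕ, F.card = k → ¬ ∃ x : Fin n → C, ∀ i ∈ F, x ∈ inst ψ (c i)

/-- A definable set `D` forks over `A`: it implies a finite disjunction of formulas (with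
parameters anywhere in `C`) each of which divides over `A`. -/
def Forks (A : Set C) {n : ℕ} (D : Set (Fin n → C)) : Prop :=
  ∃ (d : ℕ) (E : Fin d → Set (Fin n → C)), (∀ i, Divides L A (E i)) ∧ D ⊆ ⋃ i, E i

end Forking

section Types

variable {n m : ℕ} (φ : L.Formula (Fin n ⊕ Fin m))

/-- The Boolean algebra of `φ`-formulas over `A`, up to equivalence in `C`: Boolean combinations
of instances `φ(x, b)` with `b` in `A`, identified with the sets they define. -/
def phiAlg (A : Set C) : BooleanSubalgebra (Set (Fin n → C)) :=
  BooleanSubalgebra.closure {D | ∃ b : Fin m → C, (∀ i, b i ∈ A) ∧ D = inst φ b}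

theorem phiAlg_mono {A A' : Set C} (h : A ⊆ A') : phiAlg φ A ≤ phiAlg φ A' :=
  BooleanSubalgebra.closure_mono fun _ ⟨b, hb, hD⟩ => ⟨b, fun i => h (hb i), hD⟩

/-- A set of `φ`-formulas is consistent: finitely many of its members are always
simultaneously satisfiable. -/
def IsConsistent {A : Set C} (S : Set (phiAlg φ A)) : Prop :=
  ∀ F : Finset (phiAlg φ A), (F : Set (phiAlg φ A)) ⊆ S →
    ∃ x : Fin n → C, ∀ θ ∈ F, x ∈ (θ : Set (Fin n → C))

/-- A complete `φ`-type over `A`: a maximal consistent set of `φ`-formulas over `A`. -/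
structure PhiType (A : Set C) where
  carrier : Set (phiAlg φ A)
  consistent : IsConsistent φ carrier
  maximal : ∀ S : Set (phiAlg φ A), IsConsistent φ S → carrier ⊆ S → S = carrier

/-- A `𝓑, φ`-type over `A`: a Boolean algebra homomorphism from the `φ`-formulas over `A`
to `𝓑`. -/
abbrev BoolPhiType (𝓑 : Type*) [BooleanAlgebra 𝓑] (A : Set C) :=
  BoundedLatticeHom (phiAlg φ A) 𝓑

variable {φ} {𝓑 : Type*}

open Classical in
/-- A complete `φ`-type seen as a `{0, 1}`-valued function. -/
noncomputable def PhiType.val {A : Set C} (r : PhiType φ A) (𝓑 : Type*) [BooleanAlgebra 𝓑]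
    (ψ : phiAlg φ A) : 𝓑 :=
  if ψ ∈ r.carrier then ⊤ else ⊥

/-- The complete `φ`-type `s` does not fork over `A₀`. -/
def PhiType.NonForking {A : Set C} (s : PhiType φ A) (A₀ : Set C) : Prop :=
  ∀ θ ∈ s.carrier, ¬ Forks L A₀ (θ : Set (Fin n → C))

/-- For `A ⊆ A'`, the `φ`-type `s` over `A'` is an extension of the `φ`-type `r` over `A` which
does not fork over `A`. -/
def PhiType.IsNonForkingExt {A A' : Set C} (h : A ⊆ A') (r : PhiType φ A)
    (s : PhiType φ A') : Prop :=
  (∀ θ ∈ r.carrier, BooleanSubalgebra.inclusion (phiAlg_mono φ h) θ ∈ s.carrier) ∧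
    s.NonForking A

variable [BooleanAlgebra 𝓑]

/-- The `𝓑, φ`-type `q` does not fork over `A₀`: no `φ`-formula forking over `A₀` has positive
value. -/
def BoolPhiType.NonForking {A : Set C} (q : BoolPhiType φ 𝓑 A) (A₀ : Set C) : Prop :=
  ¬ ∃ θ : phiAlg φ A, Forks L A₀ (θ : Set (Fin n → C)) ∧ ⊥ < q θ

/-- The restriction of a `𝓑, φ`-type to a smaller set of parameters. -/
def BoolPhiType.restrict {A A' : Set C} (q : BoolPhiType φ 𝓑 A') (h : A ⊆ A') :
    BoolPhiType φ 𝓑 A :=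
  q.comp (BooleanSubalgebra.inclusion (phiAlg_mono φ h))

/-- The support of a `𝓑, φ`-type. -/
def BoolPhiType.supp {A : Set C} (q : BoolPhiType φ 𝓑 A) : Set (PhiType φ A) :=
  {p | ∀ θ ∈ p.carrier, ⊥ < q θ}

end Types

/-- A family of nonzero, pairwise disjoint elements of a Boolean algebra such that every
nonzero element meets some member of the family. -/
def IsMaximalAntichain {𝓑 : Type*} [BooleanAlgebra 𝓑] {ι : Type*} (b : ι → 𝓑) : Prop :=
  (∀ i, b i ≠ ⊥) ∧ (∀ i j, i ≠ j → Disjoint (b i) (b j)) ∧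
    ∀ c, (∀ i, Disjoint (b i) c) → c = ⊥

end BoolType

/-! Stability bounds half-graphs (ladders) of `φ`: by saturation, ladders of every finite length
would give an infinite one. This fact is used twice.

First, uniqueness of nonforking extensions. Let `s` be a nonforking extension of `r` and `D` a
global coheir of `tp(b / M)`. If `φ(x, b) ∈ s` while `¬φ(x, β) ∈ r` for `D`-most `β`, nondividing
along a Morley sequence of `D` makes every `θ ∈ r` consistent with iterated choices of `φ(x, β)`, `β
∈ M`. Alternating these choices with `¬φ(x, β) ∈ r` builds ladders (`IsCoheir.hasLadders`). So `s`
is read off from `r` and `D` (`inst_mem_iff_of_nonForking`). Existence is by finite satisfiability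
in `M`.

Second, atomicity of `p`. If no nonzero element below `c` decided every value of `p`, repeated
splitting below `c` would again give ladders (`exists_le_deciding`). A deciding element lies below
the weight `⨅ θ ∈ r, p θ` of a single type `r`, so the nonzero weights form a maximal antichain.

For a nonforking `q` extending `p`, the part of `q` below the weight of `r` generates only
nonforking extensions of `r`; by uniqueness `q` equals that extension there. Summing over `r` gives
the formula. -/

namespace BoolType

universe u v w

/-! ### Half-graphs and Ramsey's theorem -/

section Ladders

variable {X Y : Type*}

/-- The relation `R` has half-graphs of every finite length. -/
def HasLadders (R : X → Y → Prop) : Prop :=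
  ∀ k : ℕ, ∃ (x : ℕ → X) (y : ℕ → Y), ∀ i < k, ∀ j < k, R (x i) (y j) ↔ i < j

/-- Reversing both sequences flips the order; the offset between `k - 1 - i` and `k - j` makes the
negated relation strict, at the cost of one extra step of length. -/
theorem HasLadders.not {R : X → Y → Prop} (h : HasLadders R) :
    HasLadders fun x y => ¬ R x y := by
  intro k
  obtain ⟨x, y, hxy⟩ := h (k + 1)
  refine ⟨fun i => x (k - 1 - i), fun j => y (k - j), fun i hi j hj => ?_⟩
  beta_reduce
  rw [hxy _ (by omega) _ (by omega)]
  omega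

theorem hasLadders_not_iff {R : X → Y → Prop} :
    HasLadders (fun x y => ¬ R x y) ↔ HasLadders R :=
  ⟨fun h => by simpa using h.not, HasLadders.not⟩

/-- Ramsey's theorem for pairs of natural numbers and two colours. -/
theorem exists_strictMono_homogeneous (f : ℕ → ℕ → Prop) :
    ∃ g : ℕ → ℕ, StrictMono g ∧
      ((∀ i j, i < j → f (g i) (g j)) ∨ ∀ i j, i < j → ¬ f (g i) (g j)) := by
  -- Only points related to most others are chosen, so the finitely many demands of the earlier
  -- points are met by a common later one.
  have key : ∀ f : ℕ → ℕ → Prop, (∀ᶠ i in Filter.hyperfilter ℕ, ∀ᶠ j in Filter.hyperfilter ℕ,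
      f i j) → ∃ g : ℕ → ℕ, StrictMono g ∧ ∀ i j, i < j → f (g i) (g j) := by
    intro f hf
    obtain ⟨g, -, hg⟩ := exists_seq_of_forall_finset_exists
      (fun i => ∀ᶠ j in Filter.hyperfilter ℕ, f i j) (fun i j => i < j ∧ f i j) (by
        intro s hs
        have hgt : ∀ i ∈ s, ∀ᶠ j in (Filter.hyperfilter ℕ : Filter ℕ), i < j := fun i _ =>
          (Filter.eventually_gt_atTop i).filter_mono Nat.hyperfilter_le_atTop
        have h1 : ∀ᶠ j in (Filter.hyperfilter ℕ : Filter ℕ), ∀ i ∈ s, i < j ∧ f i j :=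
          (Filter.eventually_all_finset s).2 fun i hi => (hgt i hi).and (hs i hi)
        obtain ⟨j, hj⟩ := (hf.and h1).exists
        exact ⟨j, hj⟩)
    exact ⟨g, fun i j hij => (hg i j hij).1, fun i j hij => (hg i j hij).2⟩
  by_cases hf : ∀ᶠ i in Filter.hyperfilter ℕ, ∀ᶠ j in Filter.hyperfilter ℕ, f i j
  · obtain ⟨g, hg, h⟩ := key f hf
    exact ⟨g, hg, Or.inl h⟩
  · rw [← Ultrafilter.eventually_not] at hf
    simp only [← Ultrafilter.eventually_not] at hf
    obtain ⟨g, hg, h⟩ := key (fun i j => ¬ f i j) hf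
    exact ⟨g, hg, Or.inr h⟩

/-- Ramsey makes `R (a i) (b j)` constant for `i < j`. If true, `h₂` transfers it to `b'`, and `a`,
`b'` form a half-graph; if false, `a`, `b` form one for the negation. -/
theorem hasLadders_of_splitting {R : X → Y → Prop} (a : ℕ → X) (b b' : ℕ → Y)
    (h₁ : ∀ i j, j ≤ i → R (a i) (b j) ∧ ¬ R (a i) (b' j))
    (h₂ : ∀ i j, i < j → (R (a i) (b j) ↔ R (a i) (b' j))) : HasLadders R := by
  obtain ⟨g, hg, h | h⟩ := exists_strictMono_homogeneous fun i j => R (a i) (b j)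
  · refine fun k => ⟨a ∘ g, b' ∘ g, fun i _ j _ => ?_⟩
    rcases lt_or_ge i j with hij | hij
    · simp only [Function.comp, hij, iff_true]
      exact (h₂ _ _ (hg hij)).1 (h _ _ hij)
    · simp only [Function.comp, hij.not_gt, iff_false]
      exact (h₁ _ _ (hg.monotone hij)).2
  · rw [← hasLadders_not_iff]
    refine fun k => ⟨a ∘ g, b ∘ g, fun i _ j _ => ?_⟩
    rcases lt_or_ge i j with hij | hij
    · simp only [Function.comp, hij, iff_true]
      exact h _ _ hij
    · simp only [Function.comp, hij.not_gt, iff_false, not_not]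
      exact (h₁ _ _ (hg.monotone hij)).1

end Ladders

theorem exists_ultrafilter_of_inter {X : Type*} (𝓢 : Set (Set X)) (K : Set X)
    (huniv : Set.univ ∈ 𝓢) (hinter : ∀ S ∈ 𝓢, ∀ T ∈ 𝓢, S ∩ T ∈ 𝓢)
    (hK : ∀ S ∈ 𝓢, (S ∩ K).Nonempty) : ∃ D : Ultrafilter X, K ∈ D ∧ ∀ S ∈ 𝓢, S ∈ D := by
  let F : Filter X :=
    { sets := {T | ∃ S ∈ 𝓢, S ∩ K ⊆ T}
      univ_sets := ⟨_, huniv, Set.subset_univ _⟩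
      sets_of_superset := fun ⟨S, hS, h⟩ h' => ⟨S, hS, h.trans h'⟩
      inter_sets := fun ⟨S, hS, h⟩ ⟨T, hT, h'⟩ => ⟨S ∩ T, hinter S hS T hT, fun x hx =>
        ⟨h ⟨hx.1.1, hx.2⟩, h' ⟨hx.1.2, hx.2⟩⟩⟩ }
  have : F.NeBot := ⟨fun h => by
    obtain ⟨S, hS, h⟩ := Filter.empty_mem_iff_bot.2 h
    exact (hK S hS).ne_empty (Set.subset_empty_iff.1 h)⟩
  exact ⟨Ultrafilter.of F, Ultrafilter.of_le F ⟨_, huniv, by simp⟩,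
    fun S hS => Ultrafilter.of_le F ⟨S, hS, by simp⟩⟩

variable {L : FirstOrder.Language.{u, v}} {C : Type w} [L.Structure C]

/-! ### Definable sets and elementary substructures -/

section Definability

theorem definable_eq_param {A : Set C} {α : Type*} (x : α) {c : C} (hc : c ∈ A) :
    A.Definable L {w : α → C | w x = c} :=
  (Set.Definable.singleton_of_mem L hc).preimage_comp fun _ : Fin 1 => x

theorem definable_fiber {A : Set C} {α β : Type*} [Finite β]
    {S : Set (α ⊕ β → C)} (hS : A.Definable L S) {d : β → C} (hd : ∀ i, d i ∈ A) :
    A.Definable L {e : α → C | Sum.elim e d ∈ S} := by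
  have h := (hS.inter (Set.definable_iInter_of_finite fun i : β =>
    definable_eq_param (L := L) (Sum.inr i : α ⊕ β) (hd i))).exists_of_finite
  convert! h using 1
  ext e
  simp only [Set.mem_ofPred_eq, Set.mem_inter_iff, Set.mem_iInter, Sum.elim_inr]
  refine ⟨fun h => ⟨d, h, fun _ => rfl⟩, fun ⟨u, h, hu⟩ => ?_⟩
  rwa [← funext hu]

theorem definable_realize {A : Set C} {α β : Type*} (φ : L.Formula α) (f : α → β) :
    A.Definable L {w : β → C | φ.Realize (w ∘ f)} :=
  ((Set.empty_definable_iff.2 ⟨φ, rfl⟩ : (∅ : Set C).Definable L _).mono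
    (Set.empty_subset A)).preimage_comp f

theorem definable_inst {A : Set C} {n m : ℕ} (φ : L.Formula (Fin n ⊕ Fin m)) {b : Fin m → C}
    (hb : ∀ i, b i ∈ A) : A.Definable L (inst φ b) :=
  definable_fiber (definable_realize φ id) hb

theorem ElementarySubstructure.exists_mem_of_definable (M : L.ElementarySubstructure C)
    {α : Type*} [Finite α] {S : Set (α → C)} (hS : (M : Set C).Definable L S)
    (hne : S.Nonempty) : ∃ x ∈ S, ∀ i, x i ∈ (M : Set C) := by
  obtain ⟨φ, rfl⟩ := Set.definable_iff_exists_formula_sum.1 hS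
  obtain ⟨x, hx⟩ := hne
  have h : (φ.iExs α).Realize (M.subtype ∘ (id : M → M)) :=
    FirstOrder.Language.Formula.realize_iExs.2 ⟨x, hx⟩
  rw [FirstOrder.Language.ElementaryEmbedding.map_formula,
    FirstOrder.Language.Formula.realize_iExs] at h
  obtain ⟨y, hy⟩ := h
  refine ⟨fun i => y i, ?_, fun i => (y i).2⟩
  rw [← M.subtype.map_formula] at hy
  have : M.subtype ∘ Sum.elim id y = Sum.elim (↑) fun i => (y i : C) := by
    ext (i | i) <;> rfl
  rwa [this] at hy

theorem ElementarySubstructure.finite_of_finite (M : L.ElementarySubstructure C)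
    [Finite M] : Finite C := by
  by_contra hC
  have hC : ℵ₀ ≤ #C := by
    rw [not_finite_iff_infinite] at hC
    exact Cardinal.aleph0_le_mk C
  have h : C ⊨ FirstOrder.Language.Sentence.cardGe L (Nat.card M + 1) :=
    (FirstOrder.Language.Sentence.realize_cardGe L _).2 ((Cardinal.natCast_le_aleph0).trans hC)
  rw [← M.realize_sentence, FirstOrder.Language.Sentence.realize_cardGe,
    ← Nat.cast_card] at h
  have := Nat.cast_le.1 h
  omega

end Definability

/-! ### Saturation for finite tuples -/

section Saturation

theorem directed_superset_comp {X Y ι : Type*} {S : ι → Set X} (hS : Directed (· ⊇ ·) S)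
    {g : Set X → Set Y} (hg : Monotone g) : Directed (· ⊇ ·) fun i => g (S i) := fun i j =>
  let ⟨k, hi, hj⟩ := hS i j
  ⟨k, hg hi, hg hj⟩

theorem exists_forall_mem_of_finite {X ι : Type*} [Finite X] [Nonempty ι] (S : ι → Set X)
    (hS : Directed (· ⊇ ·) S) (hne : ∀ i, (S i).Nonempty) : ∃ x, ∀ i, x ∈ S i := by
  classical
  by_contra! h
  choose f hf using h
  have := Fintype.ofFinite X
  obtain ⟨z, hz⟩ := hS.finset_le (Finset.univ.image f)
  obtain ⟨x, hx⟩ := hne z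
  exact hf x (hz (f x) (Finset.mem_image_of_mem f (Finset.mem_univ x)) hx)

theorem isSaturated_of_finite [Finite C] (κ : Cardinal.{w}) : IsSaturated L C κ := by
  classical
  intro A _ Γ hΓ
  have : Nonempty {F : Finset (L[[A]].Formula (Fin 1)) // (F : Set _) ⊆ Γ} := ⟨⟨∅, by simp⟩⟩
  obtain ⟨c, hc⟩ := exists_forall_mem_of_finite
    (fun F : {F : Finset (L[[A]].Formula (Fin 1)) // (F : Set _) ⊆ Γ} =>
      {c : Fin 1 → C | ∀ χ ∈ F.1, χ.Realize c})
    (fun F G => ⟨⟨F.1 ∪ G.1, by simpa using ⟨F.2, G.2⟩⟩,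
      fun c hc χ h => hc χ (Finset.mem_union_left _ h),
      fun c hc χ h => hc χ (Finset.mem_union_right _ h)⟩) (fun F => hΓ F.1 F.2)
  exact ⟨c, fun χ hχ => hc ⟨{χ}, by simpa using hχ⟩ χ (by simp)⟩

/-- If `M` is finite, `κ` may be finite too; but then `C` is finite, hence saturated for every
cardinal. -/
theorem IsSaturated.exists_aleph0_lt {κ : Cardinal.{w}} (hC : IsSaturated L C κ)
    (M : L.ElementarySubstructure C) (hM : #M < κ) :
    ∃ κ' : Cardinal.{w}, ℵ₀ < κ' ∧ #M < κ' ∧ IsSaturated L C κ' := by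
  rcases finite_or_infinite M with h | h
  · have := ElementarySubstructure.finite_of_finite M
    exact ⟨Order.succ ℵ₀, Order.lt_succ _, (Cardinal.lt_aleph0_of_finite M).trans
      (Order.lt_succ _), isSaturated_of_finite _⟩
  · exact ⟨κ, (Cardinal.aleph0_le_mk M).trans_lt hM, hM, hC⟩

theorem IsSaturated.exists_forall_mem_one {κ : Cardinal.{w}} (hC : IsSaturated L C κ)
    {A : Set C} (hA : #A < κ) {ι : Type*} [Nonempty ι] (S : ι → Set (Fin 1 → C))
    (hdef : ∀ i, A.Definable L (S i)) (hS : Directed (· ⊇ ·) S) (hne : ∀ i, (S i).Nonempty) :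
    ∃ x, ∀ i, x ∈ S i := by
  classical
  choose χ hχ using hdef
  obtain ⟨c, hc⟩ := hC A hA (Set.range χ) (by
    intro F hF
    have hF' : ∀ ξ, ∃ i, ξ ∈ F → χ i = ξ := fun ξ => by
      by_cases h : ξ ∈ F
      · exact (hF h).imp fun _ h _ => h
      · exact ⟨Classical.arbitrary ι, fun h' => absurd h' h⟩
    choose g hg using hF'
    obtain ⟨z, hz⟩ := hS.finset_le (F.image g)
    obtain ⟨x, hx⟩ := hne z
    refine ⟨x, fun ξ hξ => ?_⟩
    have := hz (g ξ) (Finset.mem_image_of_mem g hξ) hx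
    rw [hχ] at this
    rw [← hg ξ hξ]
    exact this)
  exact ⟨c, fun i => by rw [hχ]; exact hc _ ⟨i, rfl⟩⟩

/-- The first coordinate is found in the projections and added to the parameters; the others are
then found in the fibres over it. -/
theorem IsSaturated.exists_forall_mem_fin {κ : Cardinal.{w}} (hC : IsSaturated L C κ)
    (hκ : ℵ₀ ≤ κ) {ι : Type*} [Nonempty ι] (k : ℕ) :
    ∀ {A : Set C}, #A < κ → ∀ S : ι → Set (Fin k → C), (∀ i, A.Definable L (S i)) →
      Directed (· ⊇ ·) S → (∀ i, (S i).Nonempty) → ∃ x, ∀ i, x ∈ S i := by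
  induction k with
  | zero => exact fun _ S _ hS hne => exists_forall_mem_of_finite S hS hne
  | succ k ih =>
    intro A hA S hdef hS hne
    obtain ⟨c, hc⟩ := hC.exists_forall_mem_one hA
      (fun i => (fun g : Fin (k + 1) → C => g ∘ fun _ : Fin 1 => (0 : Fin (k + 1))) '' S i)
      (fun i => (hdef i).image_comp _)
      (directed_superset_comp hS fun _ _ h => Set.image_mono h) (fun i => (hne i).image _)
    have hA' : #(insert (c 0) A : Set C) < κ :=
      Cardinal.mk_insert_le.trans_lt (Cardinal.add_lt_of_lt hκ hA
        (Cardinal.one_lt_aleph0.trans_le hκ))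
    obtain ⟨e, he⟩ := ih hA'
      (fun i => (fun g : Fin (k + 1) → C => g ∘ Fin.succ) '' (S i ∩ {g | g 0 = c 0}))
      (fun i => (((hdef i).mono (Set.subset_insert _ _)).inter
        (definable_eq_param 0 (Set.mem_insert _ _))).image_comp _)
      (directed_superset_comp hS (g := fun T => (fun g : Fin (k + 1) → C => g ∘ Fin.succ) ''
        (T ∩ {g | g 0 = c 0}))
        fun _ _ h => Set.image_mono (Set.inter_subset_inter_left _ h))
      (fun i => by
        obtain ⟨g, hg, hgc⟩ := hc i
        exact ⟨_, g, ⟨hg, congrFun hgc 0⟩, rfl⟩)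
    refine ⟨Fin.cons (c 0) e, fun i => ?_⟩
    obtain ⟨g, ⟨hg, hg0⟩, hge⟩ := he i
    convert! hg
    rw [← hge, ← (show g 0 = c 0 from hg0)]
    exact Fin.cons_self_tail g

theorem IsSaturated.exists_forall_mem {κ : Cardinal.{w}} (hC : IsSaturated L C κ)
    (hκ : ℵ₀ ≤ κ) {ι : Type*} [Nonempty ι] {α : Type*} [Finite α] {A : Set C} (hA : #A < κ)
    (S : ι → Set (α → C)) (hdef : ∀ i, A.Definable L (S i)) (hS : Directed (· ⊇ ·) S)
    (hne : ∀ i, (S i).Nonempty) : ∃ x, ∀ i, x ∈ S i := by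
  obtain ⟨k, ⟨f⟩⟩ := Finite.exists_equiv_fin α
  obtain ⟨x, hx⟩ := hC.exists_forall_mem_fin hκ k hA
    (fun i => (fun g : α → C => g ∘ f.symm) '' S i) (fun i => (hdef i).image_comp _)
    (directed_superset_comp hS fun _ _ h => Set.image_mono h) (fun i => (hne i).image _)
  refine ⟨x ∘ f, fun i => ?_⟩
  obtain ⟨g, hg, rfl⟩ := hx i
  convert! hg
  ext i
  simp

end Saturation

/-! ### From finite ladders to an infinite one -/

section Stability

variable {n m : ℕ}

/-- The sequence `z` is a half-graph of length `N` for `φ`. -/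
def IsLadder (φ : L.Formula (Fin n ⊕ Fin m)) (N : ℕ) (z : ℕ → Fin n ⊕ Fin m → C) : Prop :=
  ∀ i < N, ∀ j < N, z i ∘ Sum.inl ∈ inst φ (z j ∘ Sum.inr) ↔ i < j

/-- The first `k` members of `z` start half-graphs for `φ` of every length. -/
def IsLadderStart (φ : L.Formula (Fin n ⊕ Fin m)) (k : ℕ) (z : ℕ → Fin n ⊕ Fin m → C) : Prop :=
  ∀ N, ∃ z', (∀ i < k, z' i = z i) ∧ IsLadder φ N z'

theorem definable_ladder_step {A : Set C} (φ : L.Formula (Fin n ⊕ Fin m)) {k N : ℕ} (hk : k < N)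
    {z : ℕ → Fin n ⊕ Fin m → C} (hz : ∀ i < k, ∀ v, z i v ∈ A) :
    A.Definable L {e | ∃ z', (∀ i < k, z' i = z i) ∧ z' k = e ∧ IsLadder φ N z'} := by
  have h₁ : A.Definable L (⋂ (i : Fin N) (j : Fin N), {w : Fin N × (Fin n ⊕ Fin m) → C |
      φ.Realize (w ∘ Sum.elim (fun a => (i, Sum.inl a)) (fun b => (j, Sum.inr b))) ↔ i < j}) := by
    refine Set.definable_iInter_of_finite fun i => Set.definable_iInter_of_finite fun j => ?_
    by_cases hij : i < j
    · simpa only [hij, iff_true] using definable_realize φ _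
    · simp only [hij, iff_false]
      exact (definable_realize φ _).compl
  have h₂ : A.Definable L (⋂ (i : Fin k) (v : Fin n ⊕ Fin m),
      {w : Fin N × (Fin n ⊕ Fin m) → C | w (⟨i, i.2.trans hk⟩, v) = z i v}) :=
    Set.definable_iInter_of_finite fun i => Set.definable_iInter_of_finite fun v =>
      definable_eq_param _ (hz i i.2 v)
  convert! (h₁.inter h₂).image_comp fun v => ((⟨k, hk⟩ : Fin N), v) using 1
  ext e
  simp only [Set.mem_ofPred_eq, Set.mem_image, Set.mem_inter_iff, Set.mem_iInter]
  constructor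
  · rintro ⟨z', hz', rfl, hl⟩
    refine ⟨fun w => z' w.1 w.2, ⟨fun i j => ?_, fun i v => ?_⟩, rfl⟩
    · have := hl i i.2 j j.2
      rw [← Fin.lt_def] at this
      rw [← this]
      simp only [inst, Set.mem_ofPred_eq]
      refine iff_of_eq (congrArg _ ?_)
      ext (a | a) <;> rfl
    · exact congrFun (hz' i i.2) v
  · rintro ⟨w, ⟨hw, hw'⟩, rfl⟩
    refine ⟨fun i v => if h : i < N then w (⟨i, h⟩, v) else z i v, fun i hi => ?_, ?_, ?_⟩
    · ext v
      simpa [hi.trans hk] using hw' ⟨i, hi⟩ v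
    · ext v
      simp [hk]
    · intro i hi j hj
      have := hw ⟨i, hi⟩ ⟨j, hj⟩
      rw [Fin.lt_def] at this
      rw [← this]
      simp only [inst, Set.mem_ofPred_eq, hi, hj, dite_true]
      refine iff_of_eq (congrArg _ ?_)
      ext (a | a) <;> rfl

/-- The candidates for the next member that allow length `k + 1 + N` form nonempty definable sets,
decreasing in `N`, over finitely many parameters. A common point keeps every length available. -/
theorem IsSaturated.ladder_step {κ : Cardinal.{w}} (hC : IsSaturated L C κ) (hκ : ℵ₀ ≤ κ)
    (φ : L.Formula (Fin n ⊕ Fin m)) {k : ℕ} {z : ℕ → Fin n ⊕ Fin m → C}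
    (hz : IsLadderStart φ k z) : ∃ z', IsLadderStart φ (k + 1) z' ∧ ∀ i < k, z' i = z i := by
  classical
  have hfin : (⋃ i : Fin k, Set.range (z i)).Finite :=
    Set.finite_iUnion fun i => Set.finite_range _
  have hcard := (Cardinal.lt_aleph0_iff_set_finite.2 hfin).trans_le hκ
  have hmem : ∀ i < k, ∀ v, z i v ∈ ⋃ i : Fin k, Set.range (z i) := fun i hi v =>
    Set.mem_iUnion.2 ⟨⟨i, hi⟩, v, rfl⟩
  obtain ⟨e, he⟩ := hC.exists_forall_mem hκ hcard
    (fun N : ℕ => {e | ∃ z', (∀ i < k, z' i = z i) ∧ z' k = e ∧ IsLadder φ (k + 1 + N) z'})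
    (fun N => definable_ladder_step φ (by omega) hmem)
    (Antitone.directed_ge fun N N' hN e he => by
      obtain ⟨z', h, h', hl⟩ := he
      exact ⟨z', h, h', fun i hi j hj => hl i (by omega) j (by omega)⟩)
    (fun N => by
      obtain ⟨z', h, hl⟩ := hz (k + 1 + N)
      exact ⟨z' k, z', h, rfl, hl⟩)
  refine ⟨Function.update z k e, fun N => ?_, fun i hi => Function.update_of_ne hi.ne _ _⟩
  obtain ⟨z', h, h', hl⟩ := he N
  refine ⟨z', fun i hi => ?_, fun i hi j hj => hl i (by omega) j (by omega)⟩
  rcases Nat.lt_succ_iff_lt_or_eq.1 hi with hi | rfl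
  · rw [h i hi, Function.update_of_ne hi.ne]
  · rw [h', Function.update_self]

theorem IsStable.not_hasLadders {κ : Cardinal.{w}} (hC : IsSaturated L C κ) (hκ : ℵ₀ ≤ κ)
    {φ : L.Formula (Fin n ⊕ Fin m)} (hφ : IsStable C φ) :
    ¬ HasLadders fun (x : Fin n → C) y => x ∈ inst φ y := by
  intro h
  choose f hf using fun k => fun z : {z // IsLadderStart (C := C) φ k z} =>
    hC.ladder_step hκ φ z.2
  have h0 : ∃ z, IsLadderStart (C := C) φ 0 z := by
    obtain ⟨x, y, -⟩ := h 0
    refine ⟨fun i => Sum.elim (x i) (y i), fun N => ?_⟩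
    obtain ⟨x, y, hxy⟩ := h N
    exact ⟨fun i => Sum.elim (x i) (y i), by simp, fun i hi j hj => by simpa using hxy i hi j hj⟩
  let Z : ∀ k, {z // IsLadderStart (C := C) φ k z} := fun k =>
    Nat.rec ⟨h0.choose, h0.choose_spec⟩ (fun k z => ⟨f k z, (hf k z).1⟩) k
  have hZ : ∀ k, ∀ i < k, (Z (k + 1)).1 i = (Z k).1 i := fun k => (hf k (Z k)).2
  have hZ' : ∀ i k, i < k → (Z k).1 i = (Z (i + 1)).1 i := by
    intro i k hk
    induction k, hk using Nat.le_induction with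
    | base => rfl
    | succ k hk ih => rw [hZ k i hk, ih]
  refine hφ ⟨fun i => (Z (i + 1)).1 i ∘ Sum.inl, fun j => (Z (j + 1)).1 j ∘ Sum.inr,
    fun i j => ?_⟩
  obtain ⟨z', hz', hl⟩ := (Z (i + j + 1)).2 (i + j + 1)
  have := hl i (by omega) j (by omega)
  rwa [hz' i (by omega), hz' j (by omega), hZ' i _ (by omega), hZ' j _ (by omega)] at this

end Stability

/-! ### Ladders from iterated ultrafilter quantifiers -/

section Iterated

variable {X Y : Type*}

/-- For `D`-most `y₁`, for `D`-most `y₂`, …, for `D`-most `yₖ`, the set `T` meets the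
intersection of the `R yᵢ`. -/
def MostlyMeets (D : Ultrafilter Y) (R : Y → Set X) : ℕ → Set X → Prop
  | 0, T => T.Nonempty
  | k + 1, T => ∀ᶠ y in D, MostlyMeets D R k (T ∩ R y)

/-- Each new `y` does two things: `T` is cut by `(R y)ᶜ`, so later points avoid `R y`, while `T ∩ R
y` joins the list `s` of sets still owed a point in all later `R (y j)`; that point is the current
`x`. -/
theorem exists_ladder_of_mostlyMeets {D : Ultrafilter Y} {R : Y → Set X} {𝓡 : Set (Set X)}
    (hinter : ∀ S ∈ 𝓡, ∀ T ∈ 𝓡, S ∩ T ∈ 𝓡) (hR : ∀ᶠ y in D, (R y)ᶜ ∈ 𝓡)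
    (hD : ∀ T ∈ 𝓡, ∀ k, MostlyMeets D R k T) (k : ℕ) :
    ∀ T ∈ 𝓡, ∀ s : Set (Set X), s.Finite → (∀ S ∈ s, MostlyMeets D R k S) →
      ∃ y : ℕ → Y, (∀ S ∈ s, ∃ x ∈ S, ∀ j < k, x ∈ R (y j)) ∧
        ∃ x : ℕ → X, ∀ i ≤ k, x i ∈ T ∧ ∀ j < k, x i ∈ R (y j) ↔ i ≤ j := by
  induction k with
  | zero =>
    intro T hT s _ hs
    obtain ⟨y, -⟩ := hR.exists
    obtain ⟨x, hx⟩ := hD T hT 0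
    refine ⟨fun _ => y, fun S hS => ?_, fun _ => x, fun _ _ => ⟨hx, by simp⟩⟩
    obtain ⟨x, hx⟩ := hs S hS
    exact ⟨x, hx, by simp⟩
  | succ k ih =>
    intro T hT s hsf hs
    have h₁ : ∀ᶠ y in D, ∀ S ∈ insert T s, MostlyMeets D R k (S ∩ R y) :=
      (Filter.eventually_all_finite (hsf.insert T)).2 fun S hS =>
        (Set.mem_insert_iff.1 hS).elim (fun h => h ▸ hD T hT (k + 1)) (hs S)
    obtain ⟨β, hβ, hβ'⟩ := (hR.and h₁).exists
    obtain ⟨y, hy, x, hx⟩ := ih _ (hinter T hT _ hβ) ((· ∩ R β) '' insert T s)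
      ((hsf.insert T).image _) (by rintro _ ⟨S, hS, rfl⟩; exact hβ' S hS)
    have hy' : ∀ S ∈ insert T s, ∃ x ∈ S, ∀ j < k + 1,
        x ∈ R (Nat.casesOn (motive := fun _ => Y) j β y) := by
      intro S hS
      obtain ⟨x, hx, hxy⟩ := hy _ ⟨S, hS, rfl⟩
      refine ⟨x, hx.1, fun j hj => ?_⟩
      cases j with
      | zero => exact hx.2
      | succ j => exact hxy j (by omega)
    obtain ⟨x₀, hx₀, hx₀'⟩ := hy' T (Set.mem_insert _ _)
    refine ⟨fun j => Nat.casesOn (motive := fun _ => Y) j β y,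
      fun S hS => hy' S (Set.mem_insert_of_mem _ hS),
      fun i => Nat.casesOn (motive := fun _ => X) i x₀ x, fun i hi => ?_⟩
    cases i with
    | zero => exact ⟨hx₀, fun j hj => by simpa using hx₀' j hj⟩
    | succ i =>
      obtain ⟨h, h'⟩ := hx i (by omega)
      refine ⟨h.1, fun j hj => ?_⟩
      cases j with
      | zero => simpa using h.2
      | succ j => simpa using h' j (by omega)

theorem hasLadders_of_mostlyMeets {D : Ultrafilter Y} {R : Y → Set X} {𝓡 : Set (Set X)}
    (hinter : ∀ S ∈ 𝓡, ∀ T ∈ 𝓡, S ∩ T ∈ 𝓡) (hR : ∀ᶠ y in D, (R y)ᶜ ∈ 𝓡)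
    (hD : ∀ T ∈ 𝓡, ∀ k, MostlyMeets D R k T) : HasLadders fun x y => x ∈ R y := by
  intro k
  obtain ⟨β, hβ⟩ := hR.exists
  obtain ⟨y, -, x, hx⟩ := exists_ladder_of_mostlyMeets hinter hR hD k _ hβ ∅
    Set.finite_empty (by simp)
  -- Dropping `x 0` turns `i ≤ j` into `i < j`.
  exact ⟨fun i => x (i + 1), y, fun i hi j hj => ((hx (i + 1) hi).2 j hj).trans Nat.succ_le_iff⟩

end Iterated

/-! ### Coheirs, Morley sequences and dividing -/

section Coheir

variable (L)

/-- The ultrafilter `D` is a global coheir of `tp(b / M)`: it concentrates on tuples from `M` and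
contains the same sets definable over `M` as `tp(b / M)`. -/
structure IsCoheir (M : Set C) {m : ℕ} (b : Fin m → C) (D : Ultrafilter (Fin m → C)) : Prop where
  mem : ∀ᶠ β : Fin m → C in D, ∀ i, β i ∈ M
  iff : ∀ S, M.Definable L S → (S ∈ D ↔ b ∈ S)

variable {L}

theorem exists_isCoheir (M : L.ElementarySubstructure C) {m : ℕ} (b : Fin m → C) :
    ∃ D, IsCoheir L (M : Set C) b D := by
  obtain ⟨D, hM, hD⟩ := exists_ultrafilter_of_inter
    {S : Set (Fin m → C) | (M : Set C).Definable L S ∧ b ∈ S} {β | ∀ i, β i ∈ (M : Set C)}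
    ⟨Set.definable_univ, trivial⟩ (fun S hS T hT => ⟨hS.1.inter hT.1, hS.2, hT.2⟩)
    (fun S hS => ElementarySubstructure.exists_mem_of_definable M hS.1 ⟨b, hS.2⟩)
  refine ⟨D, hM, fun S hS => ⟨fun h => ?_, fun h => hD S ⟨hS, h⟩⟩⟩
  by_contra hb
  exact Ultrafilter.compl_mem_iff_notMem.1 (hD Sᶜ ⟨hS.compl, hb⟩) h

/-- Each `b i` realises `D` over `M` and the earlier terms; these add only finitely many parameters,
so saturation applies. -/
theorem IsSaturated.exists_morley {κ : Cardinal.{w}} (hC : IsSaturated L C κ) (hκ : ℵ₀ ≤ κ)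
    {M : Set C} (hM : #M < κ) {m : ℕ} (D : Ultrafilter (Fin m → C)) :
    ∃ (b : ℕ → Fin m → C) (T : ℕ → Set C),
      (∀ i S, (M ∪ T i).Definable L S → (b i ∈ S ↔ S ∈ D)) ∧
      ∀ i j, i < j → ∀ v, b i v ∈ T j := by
  obtain ⟨f, hf, hf'⟩ := exists_seq_of_forall_finset_exists
    (fun p : Set C × (Fin m → C) => p.1.Finite ∧
      ∀ S, (M ∪ p.1).Definable L S → (p.2 ∈ S ↔ S ∈ D))
    (fun p q => ∀ v, p.2 v ∈ q.1) (by
      intro s _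
      have hT : (⋃ p ∈ s, Set.range p.2).Finite :=
        s.finite_toSet.biUnion fun p _ => Set.finite_range _
      have hcard : #(M ∪ ⋃ p ∈ s, Set.range p.2 : Set C) < κ :=
        (Cardinal.mk_union_le _ _).trans_lt (Cardinal.add_lt_of_lt hκ hM
          ((Cardinal.lt_aleph0_iff_set_finite.2 hT).trans_le hκ))
      have : Nonempty {S : Set (Fin m → C) //
          (M ∪ ⋃ p ∈ s, Set.range p.2).Definable L S ∧ S ∈ D} :=
        ⟨⟨Set.univ, Set.definable_univ, Filter.univ_mem⟩⟩
      obtain ⟨b, hb⟩ := hC.exists_forall_mem hκ hcard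
        (fun S : {S : Set (Fin m → C) // (M ∪ ⋃ p ∈ s, Set.range p.2).Definable L S ∧ S ∈ D} =>
          S.1) (fun S => S.2.1)
        (fun S T => ⟨⟨S.1 ∩ T.1, S.2.1.inter T.2.1, Filter.inter_mem S.2.2 T.2.2⟩,
          Set.inter_subset_left, Set.inter_subset_right⟩)
        (fun S => Ultrafilter.nonempty_of_mem S.2.2)
      refine ⟨(_, b), ⟨hT, fun S hS => ⟨fun h => ?_, fun h => hb ⟨S, hS, h⟩⟩⟩,
        fun p hp v => Set.mem_biUnion hp ⟨v, rfl⟩⟩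
      by_contra hSD
      exact hb ⟨Sᶜ, hS.compl, Ultrafilter.compl_mem_iff_notMem.2 hSD⟩ h)
  exact ⟨fun i => (f i).2, fun i => (f i).1, fun i => (hf i).2, hf'⟩

theorem definable_setOf_meets {A : Set C} {n m : ℕ} (φ : L.Formula (Fin n ⊕ Fin m))
    {T : Set (Fin n → C)} (hT : A.Definable L T) :
    A.Definable L {β : Fin m → C | (T ∩ inst φ β).Nonempty} := by
  have h := ((hT.preimage_comp (Sum.inr : Fin n → Fin m ⊕ Fin n)).inter
    (definable_realize φ (Sum.elim Sum.inr Sum.inl))).exists_of_finite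
  convert! h using 1
  ext β
  refine exists_congr fun x => and_congr Iff.rfl (iff_of_eq (congrArg φ.Realize ?_))
  ext (a | a) <;> rfl

/-- The last term of the sequence realises `D` over the earlier ones, so it can be replaced by
`D`-most `β` in `M`. Then `φ(x, β)` is absorbed into `Θ`, which stays definable over `M`, and the
next-to-last term is treated. -/
theorem mostlyMeets_of_nonempty {M : Set C} {n m : ℕ} {φ : L.Formula (Fin n ⊕ Fin m)}
    {D : Ultrafilter (Fin m → C)} (hDM : ∀ᶠ β : Fin m → C in D, ∀ i, β i ∈ M)
    {b : ℕ → Fin m → C} {T : ℕ → Set C}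
    (hb : ∀ i S, (M ∪ T i).Definable L S → (b i ∈ S ↔ S ∈ D))
    (hT : ∀ i j, i < j → ∀ v, b i v ∈ T j) (F : Finset ℕ) :
    ∀ Θ : Set (Fin n → C), M.Definable L Θ → (∃ x ∈ Θ, ∀ i ∈ F, x ∈ inst φ (b i)) →
      MostlyMeets D (inst φ) F.card Θ := by
  induction F using Finset.induction_on_max with
  | empty =>
    rintro Θ - ⟨x, hx, -⟩
    exact ⟨x, hx⟩
  | insert l F hl ih =>
    rintro Θ hΘ ⟨x, hx, hxF⟩
    rw [Finset.card_insert_of_notMem fun h => (hl l h).false]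
    have hdef : (M ∪ T l).Definable L (Θ ∩ ⋂ i : F, inst φ (b i)) :=
      (hΘ.mono Set.subset_union_left).inter (Set.definable_iInter_of_finite fun i : F =>
        definable_inst φ fun v => Or.inr (hT i l (hl i i.2) v))
    have hmem := (hb l _ (definable_setOf_meets φ hdef)).1
      ⟨x, ⟨hx, Set.mem_iInter.2 fun i => hxF i (Finset.mem_insert_of_mem i.2)⟩,
        hxF l (Finset.mem_insert_self _ _)⟩
    filter_upwards [hDM, hmem] with β hβ ⟨y, ⟨hy, hyF⟩, hyβ⟩
    exact ih _ (hΘ.inter (definable_inst φ hβ)) ⟨y, ⟨hy, hyβ⟩, fun i hi =>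
      Set.mem_iInter.1 hyF ⟨i, hi⟩⟩

theorem exists_finset_of_not_divides {M : Set C} {n m l : ℕ} {φ : L.Formula (Fin n ⊕ Fin m)}
    {b : Fin m → C} {c : ℕ → Fin m → C} (hc : ∀ i S, M.Definable L S → (c i ∈ S ↔ b ∈ S))
    {χ : L.Formula (Fin n ⊕ Fin l)} {e : Fin l → C} (he : ∀ i, e i ∈ M)
    (h : ¬ Divides L M (inst χ e ∩ inst φ b)) (k : ℕ) :
    ∃ F : Finset ℕ, F.card = k ∧ ∃ x ∈ inst χ e, ∀ i ∈ F, x ∈ inst φ (c i) := by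
  by_contra! hF
  let ψ : L.Formula (Fin n ⊕ Fin (m + l)) :=
    χ.relabel (Sum.map id (Fin.natAdd m)) ⊓ φ.relabel (Sum.map id (Fin.castAdd l))
  have hψ : ∀ β, inst ψ (Fin.append β e) = inst χ e ∩ inst φ β := by
    intro β
    ext x
    simp only [ψ, inst, Set.mem_ofPred_eq, Set.mem_inter_iff,
      FirstOrder.Language.Formula.realize_inf, FirstOrder.Language.Formula.realize_relabel]
    refine and_congr (iff_of_eq (congrArg _ ?_)) (iff_of_eq (congrArg _ ?_)) <;>
    · ext (a | a) <;> simp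
  -- With `k + 1` the index set is nonempty even for `k = 0`, so membership in `inst χ e` can be
  -- read off one conjugate.
  refine h ⟨m + l, ψ, Fin.append b e, (hψ b).symm, k + 1, fun i => Fin.append (c i) e,
    fun i ξ => ?_, fun F hFk ⟨x, hx⟩ => ?_⟩
  · have hdef : M.Definable L {β : Fin m → C | ξ.Realize (Fin.append β e)} := by
      have h1 : M.Definable L (Set.ofPred ξ.Realize) := ⟨ξ, rfl⟩
      convert! definable_fiber (h1.preimage_comp finSumFinEquiv.symm) he using 3 with β
      simp only [Set.mem_preimage, Set.mem_ofPred_eq]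
      refine iff_of_eq (congrArg _ ?_)
      ext i
      refine Fin.addCases (fun i => ?_) (fun i => ?_) i <;> simp
    exact hc i _ hdef
  · simp only [hψ] at hx
    obtain ⟨F', hF', hk⟩ := Finset.exists_subset_card_eq (show k ≤ F.card by omega)
    obtain ⟨j, hj⟩ : F.Nonempty := Finset.card_pos.1 (by omega)
    obtain ⟨i, hi, hxi⟩ := hF F' hk x (hx j hj).1
    exact hxi (hx i (hF' hi)).2

theorem IsCoheir.hasLadders {κ : Cardinal.{w}} (hC : IsSaturated L C κ) (hκ : ℵ₀ ≤ κ)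
    {M : Set C} (hM : #M < κ) {n m : ℕ} {φ : L.Formula (Fin n ⊕ Fin m)} {b : Fin m → C}
    {D : Ultrafilter (Fin m → C)} (hD : IsCoheir L M b D) {𝓡 : Set (Set (Fin n → C))}
    (h𝓡 : ∀ θ ∈ 𝓡, ∃ (l : ℕ) (χ : L.Formula (Fin n ⊕ Fin l)) (e : Fin l → C),
      (∀ i, e i ∈ M) ∧ θ = inst χ e)
    (hinter : ∀ S ∈ 𝓡, ∀ T ∈ 𝓡, S ∩ T ∈ 𝓡) (hdiv : ∀ θ ∈ 𝓡, ¬ Divides L M (θ ∩ inst φ b))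
    (hmost : ∀ᶠ β in D, (inst φ β)ᶜ ∈ 𝓡) : HasLadders fun (x : Fin n → C) y => x ∈ inst φ y := by
  obtain ⟨c, T, hc, hT⟩ := hC.exists_morley hκ hM D
  refine hasLadders_of_mostlyMeets hinter hmost fun θ hθ k => ?_
  obtain ⟨l, χ, e, he, rfl⟩ := h𝓡 θ hθ
  obtain ⟨F, rfl, hF⟩ := exists_finset_of_not_divides (c := c)
    (fun i S hS => (hc i S (hS.mono Set.subset_union_left)).trans (hD.iff S hS)) he (hdiv _ hθ) k
  exact mostlyMeets_of_nonempty hD.mem hc hT F _ (definable_inst χ he) hF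

end Coheir

/-! ### Density of deciding elements -/

section Deciding

variable {X Y 𝓑 : Type*} [BooleanAlgebra 𝓑] {R : X → Y → Prop} {f : Y → 𝓑}

/-- Otherwise the finitely many traces on `T` are treated in turn: `c` is shrunk to meet `f y` for
one `y` with the given trace, if possible, and this settles every `y'` with that trace. The result
decides everything. -/
theorem exists_le_splitting {c : 𝓑} (hc : c ≠ ⊥)
    (hno : ∀ c' ≤ c, c' ≠ ⊥ → ∃ y, ¬ c' ≤ f y ∧ ¬ c' ≤ (f y)ᶜ) {T : Set X} (hT : T.Finite) :
    ∃ c' ≤ c, c' ≠ ⊥ ∧ ∃ y y', (∀ a ∈ T, R a y ↔ R a y') ∧ c' ≤ f y ⊓ (f y')ᶜ := by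
  classical
  by_contra! h
  have : Finite T := hT
  have : Fintype (Set T) := Fintype.ofFinite _
  have key : ∀ P : Finset (Set T), ∃ c' ≤ c, c' ≠ ⊥ ∧
      ∀ y, {a : T | R a y} ∈ P → c' ≤ f y ∨ c' ≤ (f y)ᶜ := by
    intro P
    induction P using Finset.induction_on with
    | empty => exact ⟨c, le_rfl, hc, by simp⟩
    | insert p P _ ih =>
      obtain ⟨d, hdc, hd, hdP⟩ := ih
      by_cases hy : ∃ y, {a : T | R a y} = p ∧ d ⊓ f y ≠ ⊥
      · obtain ⟨y, rfl, hy⟩ := hy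
        refine ⟨d ⊓ f y, inf_le_left.trans hdc, hy, fun y' hy' => ?_⟩
        rcases Finset.mem_insert.1 hy' with hy' | hy'
        · left
          by_contra hle
          refine h (d ⊓ f y ⊓ (f y')ᶜ) ((inf_le_left.trans inf_le_left).trans hdc)
            (fun h0 => hle (disjoint_compl_right_iff.1 (disjoint_iff.2 h0))) y y'
            (fun a ha => (Set.ext_iff.1 hy' ⟨a, ha⟩).symm) ?_
          exact inf_le_inf_right _ inf_le_right
        · exact (hdP y' hy').imp inf_le_left.trans inf_le_left.trans
      · push Not at hy
        refine ⟨d, hdc, hd, fun y' hy' => ?_⟩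
        rcases Finset.mem_insert.1 hy' with hy' | hy'
        · exact Or.inr (le_compl_iff_disjoint_right.2 (disjoint_iff.2 (hy y' hy')))
        · exact hdP y' hy'
  obtain ⟨d, hdc, hd, hdP⟩ := key Finset.univ
  obtain ⟨y, h1, h2⟩ := hno d hdc hd
  exact (hdP y (Finset.mem_univ _)).elim h1 h2

/-- If deciding fails below `c`, each stage finds a pair with equal traces on the earlier points but
separated by a smaller nonzero element; `hf` then gives a point separating all pairs so far. This is
the pattern of `hasLadders_of_splitting`. -/
theorem exists_le_deciding (hR : ¬ HasLadders R)
    (hf : ∀ c ≠ ⊥, ∀ S : Set (Y × Y), S.Finite → (∀ z ∈ S, c ≤ f z.1 ⊓ (f z.2)ᶜ) →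
      ∃ x, ∀ z ∈ S, R x z.1 ∧ ¬ R x z.2) {c : 𝓑} (hc : c ≠ ⊥) :
    ∃ c' ≤ c, c' ≠ ⊥ ∧ ∀ y, c' ≤ f y ∨ c' ≤ (f y)ᶜ := by
  by_contra! hno
  let Inv : 𝓑 × Set X × Set (Y × Y) → Prop := fun s =>
    s.1 ≤ c ∧ s.1 ≠ ⊥ ∧ s.2.1.Finite ∧ s.2.2.Finite ∧ ∀ z ∈ s.2.2, s.1 ≤ f z.1 ⊓ (f z.2)ᶜ
  have step : ∀ s : {s // Inv s}, ∃ (s' : {s // Inv s}) (a : X) (y y' : Y),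
      s.1.2.1 ⊆ s'.1.2.1 ∧ s.1.2.2 ⊆ s'.1.2.2 ∧ a ∈ s'.1.2.1 ∧ (y, y') ∈ s'.1.2.2 ∧
      (∀ a ∈ s.1.2.1, R a y ↔ R a y') ∧ ∀ z ∈ s'.1.2.2, R a z.1 ∧ ¬ R a z.2 := by
    rintro ⟨⟨d, T, S⟩, hdc, hd, hT, hS, hdS⟩
    obtain ⟨d', hd'd, hd', y, y', hy, hle⟩ :=
      exists_le_splitting (f := f) hd (fun c' hc' => hno c' (hc'.trans hdc)) hT
    have hS' : ∀ z ∈ insert (y, y') S, d' ≤ f z.1 ⊓ (f z.2)ᶜ := by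
      rintro z (rfl | hz)
      · exact hle
      · exact hd'd.trans (hdS z hz)
    obtain ⟨a, ha⟩ := hf d' hd' _ (hS.insert _) hS'
    exact ⟨⟨(d', insert a T, insert (y, y') S), hd'd.trans hdc, hd', hT.insert _, hS.insert _,
      hS'⟩, a, y, y', Set.subset_insert _ _, Set.subset_insert _ _, Set.mem_insert _ _,
      Set.mem_insert _ _, hy, ha⟩
  choose next a y y' hT hS ha hy hagree hsplit using step
  let Z : ℕ → {s // Inv s} := fun k =>
    next^[k] ⟨(c, ∅, ∅), le_rfl, hc, Set.finite_empty, Set.finite_empty, by simp⟩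
  have hZ : ∀ k, Z (k + 1) = next (Z k) := fun k => Function.iterate_succ_apply' _ _ _
  have hTm : Monotone fun k => (Z k).1.2.1 := monotone_nat_of_le_succ fun k => by
    rw [hZ]; exact hT _
  have hSm : Monotone fun k => (Z k).1.2.2 := monotone_nat_of_le_succ fun k => by
    rw [hZ]; exact hS _
  refine hR (hasLadders_of_splitting (fun k => a (Z k)) (fun k => y (Z k)) (fun k => y' (Z k))
    (fun i j hij => hsplit (Z i) (y (Z j), y' (Z j)) ?_) fun i j hij => hagree (Z j) _ ?_)
  · rw [← hZ]
    refine hSm (Nat.succ_le_succ hij) ?_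
    simp only [Nat.succ_eq_add_one, hZ]
    exact hy _
  · refine hTm (Nat.succ_le_of_lt hij) ?_
    simp only [Nat.succ_eq_add_one, hZ]
    exact ha _

end Deciding

/-! ### The algebra of `φ`-formulas and types as traces of ultrafilters -/

variable {n m : ℕ} {φ : L.Formula (Fin n ⊕ Fin m)} {A : Set C}

theorem inst_mem_phiAlg {b : Fin m → C} (hb : ∀ i, b i ∈ A) : inst φ b ∈ phiAlg φ A :=
  BooleanSubalgebra.subset_closure ⟨b, hb, rfl⟩

theorem exists_eq_inst_of_mem_phiAlg {D : Set (Fin n → C)} (hD : D ∈ phiAlg φ A) :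
    ∃ (l : ℕ) (χ : L.Formula (Fin n ⊕ Fin l)) (e : Fin l → C), (∀ i, e i ∈ A) ∧ D = inst χ e := by
  induction hD using BooleanSubalgebra.closure_bot_sup_induction with
  | mem D hD =>
    obtain ⟨b, hb, rfl⟩ := hD
    exact ⟨m, φ, b, hb, rfl⟩
  | bot => exact ⟨0, ⊥, Fin.elim0, fun i => i.elim0, by ext; simp [inst]⟩
  | sup D _ E _ hD hE =>
    obtain ⟨l, χ, e, he, rfl⟩ := hD
    obtain ⟨l', χ', e', he', rfl⟩ := hE
    refine ⟨l + l', χ.relabel (Sum.map id (Fin.castAdd l')) ⊔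
      χ'.relabel (Sum.map id (Fin.natAdd l)), Fin.append e e', fun i => ?_, ?_⟩
    · refine Fin.addCases (fun i => ?_) (fun i => ?_) i
      · simpa using he i
      · simpa using he' i
    · ext x
      simp only [inst, Set.sup_eq_union, Set.mem_ofPred_eq, Set.mem_union,
        FirstOrder.Language.Formula.realize_sup, FirstOrder.Language.Formula.realize_relabel]
      refine or_congr (iff_of_eq (congrArg χ.Realize ?_)) (iff_of_eq (congrArg χ'.Realize ?_)) <;>
      · ext (a | a) <;> simp
  | compl D _ hD =>
    obtain ⟨l, χ, e, he, rfl⟩ := hD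
    exact ⟨l, χ.not, e, he, by ext; simp [inst]⟩

theorem definable_of_mem_phiAlg {D : Set (Fin n → C)} (hD : D ∈ phiAlg φ A) :
    A.Definable L D := by
  obtain ⟨l, χ, e, he, rfl⟩ := exists_eq_inst_of_mem_phiAlg hD
  exact definable_inst χ he

theorem inst_not (b : Fin m → C) : inst φ.not b = (inst φ b)ᶜ := rfl

namespace PhiType

theorem ext_carrier {s t : PhiType φ A} (h : s.carrier = t.carrier) : s = t := by
  cases s
  cases t
  congr

variable (φ A) in
/-- The complete `φ`-type over `A` of an ultrafilter. -/
def ofUltrafilter (U : Ultrafilter (Fin n → C)) : PhiType φ A where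
  carrier := {θ | (θ : Set (Fin n → C)) ∈ U}
  consistent F hF := by
    have h : ⋂ θ ∈ F, (θ : Set (Fin n → C)) ∈ U := (Filter.biInter_finset_mem F).2 hF
    obtain ⟨x, hx⟩ := Ultrafilter.nonempty_of_mem h
    exact ⟨x, by simpa using hx⟩
  maximal S hS hsub := by
    classical
    refine (hsub.antisymm fun θ hθ => ?_).symm
    by_contra h
    have h' : θᶜ ∈ S := hsub (Ultrafilter.compl_mem_iff_notMem.2 h)
    obtain ⟨x, hx⟩ := hS {θ, θᶜ} (by simp [Set.insert_subset_iff, hθ, h'])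
    exact hx θᶜ (by simp) (hx θ (by simp))

theorem exists_eq_ofUltrafilter (s : PhiType φ A) : ∃ U, s = ofUltrafilter φ A U := by
  classical
  obtain ⟨U, -, hU⟩ := exists_ultrafilter_of_inter
    {T : Set (Fin n → C) | ∃ F : Finset (phiAlg φ A), (F : Set (phiAlg φ A)) ⊆ s.carrier ∧
      T = {x | ∀ θ ∈ F, x ∈ (θ : Set (Fin n → C))}} Set.univ
    ⟨∅, by simp, by simp⟩
    (by
      rintro _ ⟨F, hF, rfl⟩ _ ⟨G, hG, rfl⟩
      refine ⟨F ∪ G, by simp [hF, hG], ?_⟩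
      ext x
      simp only [Set.mem_inter_iff, Set.mem_ofPred_eq, Finset.mem_union, or_imp, forall_and])
    (by
      rintro _ ⟨F, hF, rfl⟩
      obtain ⟨x, hx⟩ := s.consistent F hF
      exact ⟨x, hx, trivial⟩)
  refine ⟨U, ext_carrier (s.maximal _ (ofUltrafilter φ A U).consistent fun θ hθ =>
    hU _ ⟨{θ}, by simpa using hθ, by ext; simp⟩).symm⟩

theorem ofUltrafilter_eq_of_inst {U V : Ultrafilter (Fin n → C)}
    (h : ∀ b : Fin m → C, (∀ i, b i ∈ A) → (inst φ b ∈ U ↔ inst φ b ∈ V)) :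
    ofUltrafilter φ A U = ofUltrafilter φ A V := by
  refine ext_carrier (Set.ext fun ⟨D, hD⟩ => ?_)
  change D ∈ U ↔ D ∈ V
  induction hD using BooleanSubalgebra.closure_bot_sup_induction with
  | mem D hD =>
    obtain ⟨b, hb, rfl⟩ := hD
    exact h b hb
  | bot => simp
  | sup D _ E _ hD hE =>
    change D ∪ E ∈ U ↔ D ∪ E ∈ V
    rw [Ultrafilter.union_mem_iff, Ultrafilter.union_mem_iff, hD, hE]
  | compl D _ hD => rw [Ultrafilter.compl_mem_iff_notMem, Ultrafilter.compl_mem_iff_notMem, hD]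

end PhiType

/-! ### Forking and existence of nonforking extensions -/

theorem Divides.forks {D : Set (Fin n → C)} (h : Divides L A D) : Forks L A D :=
  ⟨1, fun _ => D, fun _ => h, by simp [Set.iUnion_const]⟩

theorem SameType.mem_iff {k : ℕ} {c b : Fin k → C} (h : SameType L A c b) {S : Set (Fin k → C)}
    (hS : A.Definable L S) : c ∈ S ↔ b ∈ S := by
  obtain ⟨χ, rfl⟩ := hS
  exact h χ

/-- A point over `A` lying in `D` lies in every conjugate of `D` over `A`, so no family of
conjugates is `k`-inconsistent. -/
theorem Divides.notMem {D : Set (Fin n → C)} (h : Divides L A D) {x : Fin n → C}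
    (hx : ∀ i, x i ∈ A) : x ∉ D := by
  obtain ⟨l, ψ, b, rfl, k, c, hc, hk⟩ := h
  intro hxb
  have hdef : A.Definable L {y : Fin l → C | x ∈ inst ψ y} := by
    convert! definable_fiber (definable_realize ψ Sum.swap) hx using 3 with y
    refine iff_of_eq (congrArg ψ.Realize ?_)
    ext (a | a) <;> rfl
  exact hk (Finset.range k) (Finset.card_range k) ⟨x, fun i _ => ((hc i).mem_iff hdef).2 hxb⟩

theorem Forks.notMem {D : Set (Fin n → C)} (h : Forks L A D) {x : Fin n → C}
    (hx : ∀ i, x i ∈ A) : x ∉ D := fun hxD => by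
  obtain ⟨d, E, hE, hD⟩ := h
  obtain ⟨i, hi⟩ := Set.mem_iUnion.1 (hD hxD)
  exact (hE i).notMem hx hi

/-- The extension is finitely satisfiable in `M`, while a forking set has no point in `M`. -/
theorem PhiType.exists_nonForkingExt (M : L.ElementarySubstructure C) {N : Set C}
    (hMN : (M : Set C) ⊆ N) (r : PhiType φ (M : Set C)) :
    ∃ s : PhiType φ N, r.IsNonForkingExt hMN s := by
  obtain ⟨V, rfl⟩ := r.exists_eq_ofUltrafilter
  obtain ⟨U, hM, hU⟩ := exists_ultrafilter_of_inter
    {S : Set (Fin n → C) | S ∈ phiAlg φ (M : Set C) ∧ S ∈ V} {x | ∀ i, x i ∈ (M : Set C)}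
    ⟨BooleanSubalgebra.top_mem, Filter.univ_mem⟩
    (fun S hS T hT => ⟨BooleanSubalgebra.inf_mem hS.1 hT.1, Filter.inter_mem hS.2 hT.2⟩)
    (fun S hS => ElementarySubstructure.exists_mem_of_definable M
      (definable_of_mem_phiAlg hS.1) (Ultrafilter.nonempty_of_mem hS.2))
  refine ⟨ofUltrafilter φ N U, fun θ hθ => hU _ ⟨θ.2, hθ⟩, fun θ hθ hfork => ?_⟩
  obtain ⟨x, hx, hxM⟩ := Ultrafilter.nonempty_of_mem (Filter.inter_mem hθ hM)
  exact hfork.notMem hxM hx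

/-! ### Uniqueness of nonforking extensions -/

section Uniqueness

variable {κ : Cardinal.{w}} (hC : IsSaturated L C κ) (hκ : ℵ₀ ≤ κ)
include hC hκ

/-- The right-hand side does not mention `U`, whence uniqueness. A failure of either implication
gives ladders, for `φ` or for `φ.not`. -/
theorem inst_mem_iff_of_nonForking (hφ : IsStable C φ) {M : L.ElementarySubstructure C}
    (hM : #M < κ) {N : Set C} (hMN : (M : Set C) ⊆ N) {U V : Ultrafilter (Fin n → C)}
    (h : PhiType.IsNonForkingExt hMN (PhiType.ofUltrafilter φ (M : Set C) V)
      (PhiType.ofUltrafilter φ N U)) {b : Fin m → C} (hb : ∀ i, b i ∈ N)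
    {D : Ultrafilter (Fin m → C)} (hD : IsCoheir L (M : Set C) b D) :
    inst φ b ∈ U ↔ ∀ᶠ β in D, inst φ β ∈ V := by
  have key : ∀ χ : L.Formula (Fin n ⊕ Fin m), (∀ B : Set C, ∀ β : Fin m → C, (∀ i, β i ∈ B) →
      inst χ β ∈ phiAlg φ B) → inst χ b ∈ U → (∀ᶠ β in D, (inst χ β)ᶜ ∈ V) →
      HasLadders fun (x : Fin n → C) y => x ∈ inst χ y := by
    intro χ hχ hbU hV
    refine hD.hasLadders hC hκ hM (𝓡 := {S | S ∈ phiAlg φ (M : Set C) ∧ S ∈ V})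
      (fun θ hθ => exists_eq_inst_of_mem_phiAlg hθ.1)
      (fun S hS T hT => ⟨BooleanSubalgebra.inf_mem hS.1 hT.1, Filter.inter_mem hS.2 hT.2⟩)
      (fun θ hθ hdiv => ?_) ?_
    · exact h.2 ⟨θ ∩ inst χ b, BooleanSubalgebra.inf_mem (phiAlg_mono φ hMN hθ.1) (hχ N b hb)⟩
        (Filter.inter_mem (h.1 ⟨θ, hθ.1⟩ hθ.2) hbU) hdiv.forks
    · filter_upwards [hV, hD.mem] with β hβ hβM
      exact ⟨BooleanSubalgebra.compl_mem (hχ _ β hβM), hβ⟩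
  have hstable := hφ.not_hasLadders hC hκ
  constructor
  · intro hbU
    by_contra hV
    rw [← Ultrafilter.eventually_not] at hV
    refine hstable (key φ (fun B β hβ => inst_mem_phiAlg hβ) hbU ?_)
    filter_upwards [hV] with β hβ using Ultrafilter.compl_mem_iff_notMem.2 hβ
  · intro hV
    by_contra hbU
    refine hstable (hasLadders_not_iff.1 (key φ.not (fun B β hβ =>
      BooleanSubalgebra.compl_mem (inst_mem_phiAlg hβ))
      (Ultrafilter.compl_mem_iff_notMem.2 hbU) ?_))
    filter_upwards [hV] with β hβ
    rwa [inst_not, compl_compl]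

theorem PhiType.IsNonForkingExt.unique (hφ : IsStable C φ) {M : L.ElementarySubstructure C}
    (hM : #M < κ) {N : Set C} {hMN : (M : Set C) ⊆ N} {r : PhiType φ (M : Set C)}
    {s t : PhiType φ N} (hs : r.IsNonForkingExt hMN s) (ht : r.IsNonForkingExt hMN t) :
    s = t := by
  obtain ⟨V, rfl⟩ := r.exists_eq_ofUltrafilter
  obtain ⟨U, rfl⟩ := s.exists_eq_ofUltrafilter
  obtain ⟨U', rfl⟩ := t.exists_eq_ofUltrafilter
  refine PhiType.ofUltrafilter_eq_of_inst fun b hb => ?_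
  obtain ⟨D, hD⟩ := exists_isCoheir M b
  rw [inst_mem_iff_of_nonForking hC hκ hφ hM hMN hs hb hD,
    inst_mem_iff_of_nonForking hC hκ hφ hM hMN ht hb hD]

end Uniqueness

/-! ### Weights of types and the decomposition formula -/

section Boolean

theorem BoolPhiType.exists_ultrafilter {𝓑 : Type*} [BooleanAlgebra 𝓑] (q : BoolPhiType φ 𝓑 A)
    {c : 𝓑} (hc : c ≠ ⊥) :
    ∃ U : Ultrafilter (Fin n → C), ∀ θ, c ≤ q θ → (θ : Set (Fin n → C)) ∈ U := by
  obtain ⟨U, -, hU⟩ := exists_ultrafilter_of_inter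
    {S : Set (Fin n → C) | ∃ θ : phiAlg φ A, c ≤ q θ ∧ S = θ} Set.univ
    ⟨⊤, by simp, rfl⟩
    (by
      rintro _ ⟨θ, hθ, rfl⟩ _ ⟨η, hη, rfl⟩
      exact ⟨θ ⊓ η, by rw [map_inf]; exact le_inf hθ hη, rfl⟩)
    (by
      rintro _ ⟨θ, hθ, rfl⟩
      rw [Set.inter_univ, Set.nonempty_iff_ne_empty]
      intro h
      have h0 : θ = ⊥ := Subtype.ext h
      rw [h0, map_bot] at hθ
      exact hc (le_bot_iff.1 hθ))
  exact ⟨U, fun θ hθ => hU _ ⟨θ, hθ, rfl⟩⟩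

theorem BoolPhiType.exists_le_deciding {𝓑 : Type*} [BooleanAlgebra 𝓑] (p : BoolPhiType φ 𝓑 A)
    (hφ : ¬ HasLadders fun (x : Fin n → C) y => x ∈ inst φ y) {c : 𝓑} (hc : c ≠ ⊥) :
    ∃ c' ≤ c, c' ≠ ⊥ ∧ ∀ θ, c' ≤ p θ ∨ c' ≤ (p θ)ᶜ := by
  obtain ⟨c', hcc, hc', h⟩ := BoolType.exists_le_deciding
    (R := fun (x : Fin n → C) (y : {b : Fin m → C // ∀ i, b i ∈ A}) => x ∈ inst φ y.1)
    (f := fun y => p ⟨inst φ y.1, inst_mem_phiAlg y.2⟩)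
    (fun h => hφ fun k => by
      obtain ⟨x, y, hxy⟩ := h k
      exact ⟨x, fun j => (y j).1, hxy⟩)
    (by
      intro c hc S hS hle
      obtain ⟨U, hU⟩ := p.exists_ultrafilter hc
      have : ∀ᶠ x in U, ∀ z ∈ S, x ∈ inst φ z.1.1 ∧ ¬ x ∈ inst φ z.2.1 :=
        (Filter.eventually_all_finite hS).2 fun z hz => by
          have h1 := hU _ ((hle z hz).trans inf_le_left)
          have h2 := hU (⟨inst φ z.2.1, inst_mem_phiAlg z.2.2⟩)ᶜ
            (by rw [map_compl']; exact (hle z hz).trans inf_le_right)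
          filter_upwards [h1, h2] with x hx hx' using ⟨hx, hx'⟩
      exact this.exists) hc
  refine ⟨c', hcc, hc', fun ⟨D, hD⟩ => ?_⟩
  induction hD using BooleanSubalgebra.closure_bot_sup_induction with
  | mem D hD =>
    obtain ⟨b, hb, rfl⟩ := hD
    exact h ⟨b, hb⟩
  | bot =>
    right
    rw [BooleanSubalgebra.mk_bot, map_bot, compl_bot]
    exact le_top
  | sup D hD' E hE' hD hE =>
    let a : phiAlg φ A := ⟨D, hD'⟩
    let b : phiAlg φ A := ⟨E, hE'⟩
    change c' ≤ p (a ⊔ b) ∨ c' ≤ (p (a ⊔ b))ᶜ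
    rw [map_sup, compl_sup]
    rcases hD with hD | hD
    · exact Or.inl (le_sup_of_le_left hD)
    · exact hE.imp le_sup_of_le_right (le_inf hD)
  | compl D hD' hD =>
    let a : phiAlg φ A := ⟨D, hD'⟩
    change c' ≤ p aᶜ ∨ c' ≤ (p aᶜ)ᶜ
    rw [map_compl', compl_compl]
    exact hD.symm

variable {𝓑 : Type*} [CompleteBooleanAlgebra 𝓑]

/-- The part of `𝓑` on which the `𝓑, φ`-type `p` coincides with the complete `φ`-type `r`. -/
def BoolPhiType.weight (p : BoolPhiType φ 𝓑 A) (r : PhiType φ A) : 𝓑 :=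
  ⨅ θ ∈ r.carrier, p θ

theorem BoolPhiType.weight_le (p : BoolPhiType φ 𝓑 A) {r : PhiType φ A} {θ : phiAlg φ A}
    (hθ : θ ∈ r.carrier) : p.weight r ≤ p θ :=
  iInf₂_le θ hθ

/-- Distinct types contain complementary formulas, so their weights are disjoint. For maximality, a
deciding `c'` below a given nonzero element lies below the weight of the type of all `θ` with `c' ≤
p θ`. -/
theorem BoolPhiType.isMaximalAntichain_weight (p : BoolPhiType φ 𝓑 A)
    (hφ : ¬ HasLadders fun (x : Fin n → C) y => x ∈ inst φ y) :
    IsMaximalAntichain fun r : {r | p.weight r ≠ ⊥} => p.weight r := by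
  refine ⟨fun r => r.2, fun ⟨r, _⟩ ⟨r', _⟩ hne => ?_, fun c hc => ?_⟩
  · obtain ⟨U, rfl⟩ := r.exists_eq_ofUltrafilter
    obtain ⟨U', rfl⟩ := r'.exists_eq_ofUltrafilter
    have : ∃ θ : phiAlg φ A, (θ : Set (Fin n → C)) ∈ U ∧ (θ : Set (Fin n → C)) ∉ U' := by
      by_contra! h
      refine hne (Subtype.ext (PhiType.ext_carrier ?_))
      exact ((PhiType.ofUltrafilter φ A U).maximal _
        (PhiType.ofUltrafilter φ A U').consistent h).symm
    obtain ⟨θ, hθ, hθ'⟩ := this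
    refine Disjoint.mono (p.weight_le (θ := θ) hθ) (p.weight_le (θ := θᶜ) ?_) ?_
    · exact Ultrafilter.compl_mem_iff_notMem.2 hθ'
    · rw [map_compl']
      exact disjoint_compl_right
  · by_contra h
    obtain ⟨c', hcc, hc', hdec⟩ := p.exists_le_deciding hφ h
    obtain ⟨U, hU⟩ := p.exists_ultrafilter hc'
    have hle : c' ≤ p.weight (PhiType.ofUltrafilter φ A U) := le_iInf₂ fun θ hθ => by
      refine (hdec θ).resolve_right fun hθ' => ?_
      rw [← map_compl'] at hθ'
      exact Ultrafilter.compl_mem_iff_notMem.1 (hU _ hθ') hθ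
    exact hc' (le_bot_iff.1 (hc ⟨_, fun h0 => hc' (le_bot_iff.1 (h0 ▸ hle))⟩ hle hcc))

/-- If the weight met `(q ψ)ᶜ`, a type over `A'` generated below the meet would extend `r`, contain
`ψᶜ` and omit all forking formulas, as `q` gives these value `⊥`; so it would be `t`. -/
theorem BoolPhiType.weight_le_of_nonForking {A' : Set C} {h : A ⊆ A'} {q : BoolPhiType φ 𝓑 A'}
    (hq : q.NonForking A) {r : PhiType φ A} {t : PhiType φ A'}
    (ht : ∀ s, r.IsNonForkingExt h s → s = t) {ψ : phiAlg φ A'} (hψ : ψ ∈ t.carrier) :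
    (q.restrict h).weight r ≤ q ψ := by
  by_contra hle
  have hc : (q.restrict h).weight r ⊓ (q ψ)ᶜ ≠ ⊥ := fun h0 =>
    hle (disjoint_compl_right_iff.1 (disjoint_iff.2 h0))
  obtain ⟨U, hU⟩ := q.exists_ultrafilter hc
  have hs : r.IsNonForkingExt h (PhiType.ofUltrafilter φ A' U) := by
    refine ⟨fun θ hθ => hU _ (inf_le_left.trans ((q.restrict h).weight_le hθ)),
      fun θ hθ hfork => ?_⟩
    have h0 : q θ = ⊥ := not_bot_lt_iff.1 fun h1 => hq ⟨θ, hfork, h1⟩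
    refine Ultrafilter.compl_mem_iff_notMem.1 (hU θᶜ ?_) hθ
    rw [map_compl', h0, compl_bot]
    exact le_top
  rw [← ht _ hs] at hψ
  refine Ultrafilter.compl_mem_iff_notMem.1 (hU ψᶜ ?_) hψ
  rw [map_compl']
  exact inf_le_right

theorem BoolPhiType.eq_iSup_weight {A' : Set C} {h : A ⊆ A'} {q : BoolPhiType φ 𝓑 A'}
    (hq : q.NonForking A) (hφ : ¬ HasLadders fun (x : Fin n → C) y => x ∈ inst φ y)
    {ext : PhiType φ A → PhiType φ A'} (hext : ∀ r s, r.IsNonForkingExt h s → s = ext r)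
    (ψ : phiAlg φ A') :
    q ψ = ⨆ r : {r | (q.restrict h).weight r ≠ ⊥},
      (q.restrict h).weight r ⊓ (ext r).val 𝓑 ψ := by
  refine le_antisymm ?_ (iSup_le fun r => ?_)
  -- The difference of the two sides is disjoint from every weight, so it vanishes by maximality.
  · rw [← disjoint_compl_right_iff, disjoint_iff]
    refine ((q.restrict h).isMaximalAntichain_weight hφ).2.2 _ fun r => ?_
    by_cases hψ : ψ ∈ (ext r).carrier
    · refine Disjoint.mono_right inf_le_right (disjoint_compl_right_iff.2 ?_)
      refine le_iSup_of_le r ?_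
      simp [PhiType.val, hψ]
    · refine Disjoint.mono_right inf_le_left (le_compl_iff_disjoint_right.1 ?_)
      rw [← map_compl']
      refine weight_le_of_nonForking hq (hext r) ?_
      obtain ⟨U, hU⟩ := (ext r).exists_eq_ofUltrafilter
      rw [hU] at hψ ⊢
      exact Ultrafilter.compl_mem_iff_notMem.2 hψ
  · by_cases hψ : ψ ∈ (ext r).carrier
    · exact inf_le_left.trans (weight_le_of_nonForking hq (hext r) hψ)
    · simp [PhiType.val, hψ]

end Boolean

end BoolType

theorem mainTheorem9
    {L : FirstOrder.Language} {C : Type*} [L.Structure C] [Nonempty C]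
    (κ : Cardinal) (hC : BoolType.IsSaturated L C κ)
    {n m : ℕ} (φ : L.Formula (Fin n ⊕ Fin m)) (hφ : BoolType.IsStable C φ)
    (𝓑 : Type*) [CompleteBooleanAlgebra 𝓑]
    (M : L.ElementarySubstructure C) (hM : Cardinal.mk M < κ)
    (p : BoolType.BoolPhiType φ 𝓑 (M : Set C)) :
    (∃ (U : Set (BoolType.PhiType φ (M : Set C))) (b : U → 𝓑),
      U ⊆ BoolType.BoolPhiType.supp p ∧ BoolType.IsMaximalAntichain b ∧
      ∀ (N : L.ElementarySubstructure C) (hMN : (M : Set C) ⊆ (N : Set C)),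
        ∃ ext : BoolType.PhiType φ (M : Set C) → BoolType.PhiType φ (N : Set C),
          (∀ r s, BoolType.PhiType.IsNonForkingExt hMN r s ↔ s = ext r) ∧
          ∀ q : BoolType.BoolPhiType φ 𝓑 (N : Set C),
            BoolType.BoolPhiType.NonForking q (M : Set C) →
            BoolType.BoolPhiType.restrict q hMN = p →
            ∀ ψ : BoolType.phiAlg φ (N : Set C),
              q ψ = ⨆ r : U, b r ⊓ (ext r).val 𝓑 ψ) ∧
    (∀ (N : L.ElementarySubstructure C) (hMN : (M : Set C) ⊆ (N : Set C))
      (q q' : BoolType.BoolPhiType φ 𝓑 (N : Set C)),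
        BoolType.BoolPhiType.NonForking q (M : Set C) →
        BoolType.BoolPhiType.restrict q hMN = p →
        BoolType.BoolPhiType.NonForking q' (M : Set C) →
        BoolType.BoolPhiType.restrict q' hMN = p →
        q' = q) := by
  obtain ⟨κ', hκ, hM', hC'⟩ := hC.exists_aleph0_lt M hM
  have hladder := hφ.not_hasLadders hC' hκ.le
  have hext : ∀ (N : L.ElementarySubstructure C) (hMN : (M : Set C) ⊆ (N : Set C)),
      ∃ ext : BoolType.PhiType φ (M : Set C) → BoolType.PhiType φ (N : Set C),
        ∀ r s, BoolType.PhiType.IsNonForkingExt hMN r s ↔ s = ext r := by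
    intro N hMN
    choose ext h using fun r : BoolType.PhiType φ (M : Set C) => r.exists_nonForkingExt M hMN
    exact ⟨ext, fun r s => ⟨fun hs => hs.unique hC' hκ.le hφ hM' (h r), fun hs => hs ▸ h r⟩⟩
  -- The weights are computed from `p` alone, before `N` is chosen.
  refine ⟨⟨{r | p.weight r ≠ ⊥}, fun r => p.weight r, fun r hr θ hθ =>
    (bot_lt_iff_ne_bot.2 hr).trans_le (p.weight_le hθ),
    p.isMaximalAntichain_weight hladder, fun N hMN => ?_⟩, fun N hMN q q' hq hqp hq' hqp' => ?_⟩
  · obtain ⟨ext, h⟩ := hext N hMN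
    refine ⟨ext, h, ?_⟩
    rintro q hq rfl ψ
    exact BoolType.BoolPhiType.eq_iSup_weight hq hladder (fun r s => (h r s).1) ψ
  · obtain ⟨ext, h⟩ := hext N hMN
    refine DFunLike.ext _ _ fun ψ => ?_
    rw [BoolType.BoolPhiType.eq_iSup_weight hq (h := hMN) hladder (fun r s => (h r s).1) ψ,
      BoolType.BoolPhiType.eq_iSup_weight hq' (h := hMN) hladder (fun r s => (h r s).1) ψ,
      hqp, hqp']
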